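/- **Theorem 3.1.** Let $F$ be a field of characteristic zero and let $L$ be a finite-dimensional (right) Leibniz algebra over $F$, that is, a finite-dimensional $F$-vector space with a bilinear product satisfying $[x,[y,z]]=[[x,y],z]-[[x,z],y]$ for all $x,y,z\in L$. A subalgebra $C$ of $L$ is a *subideal* of $L$ if there is a finite chain of subalgebras $C=C_t\subset C_{t-1}\subset\dots\subset C_0=L$ ($t\ge 0$) with each $C_i$ a (two-sided) ideal of $C_{i-1}$. A subalgebra $U$ of $L$ is a *weak c-ideal* of $L$ if there is a subideal $C$ of $L$ such that $L=U+C$ and $U\cap C\subseteq U_L$, where $U_L$ is the largest ideal of $L$ contained in $U$. A subalgebra $B$ is *solvable* if $B^{(n)}=0$ for some $n$, where $B^{(0)}=B$ and $B^{(k+1)}=[B^{(k)},B^{(k)}]$ is the linear span of the products of two elements of $B^{(k)}$. A *maximal subalgebra* of $L$ is a proper subalgebra contained in no other proper subalgebra. Let $B$ be an ideal of $L$. Then $B$ is solvable if and only if every maximal subalgebra of $L$ that does not contain $B$ is a weak c-ideal of $L$. In particular (Corollary 3.2), $L$ is solvable if and only if every maximal subalgebra of $L$ is a weak c-ideal of $L$.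 -/

import Mathlib

namespace Leibniz

/-- The right Leibniz identity `[x,[y,z]] = [[x,y],z] - [[x,z],y]`, where the bilinear product
`[x,y]` of the (not necessarily associative, not necessarily unital) algebra is written `x * y`.
A Leibniz algebra over a field `F` is a type `L` with
`[NonUnitalNonAssocRing L] [Module F L] [IsScalarTower F L L] [SMulCommClass F L L]`
(a vector space with a bilinear product) together with `[IsRightLeibniz L]`. -/
class IsRightLeibniz (L : Type*) [NonUnitalNonAssocRing L] : Prop where
  mul_mul_right : ∀ x y z : L, x * (y * z) = (x * y) * z - (x * z) * y

section

variable {F L : Type*} [Field F] [NonUnitalNonAssocRing L] [Module F L]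

/-- The subalgebra `A` is contained in the subalgebra `D` and is a (two-sided) ideal of `D`. -/
def IsIdealIn (A D : NonUnitalSubalgebra F L) : Prop :=
  A ≤ D ∧ ∀ a ∈ A, ∀ d ∈ D, a * d ∈ A ∧ d * a ∈ A

/-- `A` is a (two-sided) ideal of the whole algebra. -/
def IsIdeal (A : NonUnitalSubalgebra F L) : Prop :=
  ∀ a ∈ A, ∀ x : L, a * x ∈ A ∧ x * a ∈ A

variable [IsScalarTower F L L] [SMulCommClass F L L]

/-- `C` is a subideal of `L`: there is a strictly decreasing chain
`L = E 0 ⊃ E 1 ⊃ ⋯ ⊃ E t = C` of subalgebras, each an ideal of the one before it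
(`t = 0` is allowed, so that `L` is a subideal of itself). -/
def IsSubideal (C : NonUnitalSubalgebra F L) : Prop :=
  ∃ (t : ℕ) (E : ℕ → NonUnitalSubalgebra F L), E 0 = ⊤ ∧ E t = C ∧
    ∀ i < t, E (i + 1) < E i ∧ IsIdealIn (E (i + 1)) (E i)

/-- The derived series of a subalgebra `B`, as subspaces of `L`: `B⁽⁰⁾ = B`, and `B⁽ᵏ⁺¹⁾` is the
linear span of the products of two elements of `B⁽ᵏ⁾`. -/
def derived (B : NonUnitalSubalgebra F L) : ℕ → Submodule F L
  | 0 => B.toSubmodule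
  | k + 1 => Submodule.span F {z | ∃ x ∈ derived B k, ∃ y ∈ derived B k, z = x * y}

/-- The subalgebra `B` is solvable. -/
def IsSolvableSubalgebra (B : NonUnitalSubalgebra F L) : Prop :=
  ∃ n : ℕ, derived B n = ⊥

/-- The core `B_L` of a subalgebra `B`: the largest ideal of `L` contained in `B`
(see `isGreatest_core`). -/
def core (B : NonUnitalSubalgebra F L) : NonUnitalSubalgebra F L :=
  sSup {A | IsIdeal A ∧ A ≤ B}

/-- In a Leibniz algebra, `core B` is indeed the largest ideal contained in `B`. -/
theorem isGreatest_core [IsRightLeibniz L] (B : NonUnitalSubalgebra F L) :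
    IsGreatest {A : NonUnitalSubalgebra F L | IsIdeal A ∧ A ≤ B} (core B) := by
  refine ⟨⟨?_, sSup_le fun A hA => hA.2⟩, fun A hA => le_sSup hA⟩
  intro a ha
  suffices key : a ∈ core B ∧ ∀ x : L, a * x ∈ core B ∧ x * a ∈ core B from key.2
  have ha' : a ∈ NonUnitalAlgebra.adjoin F
      (⋃ A ∈ {A : NonUnitalSubalgebra F L | IsIdeal A ∧ A ≤ B}, (A : Set L)) := by
    refine (sSup_le ?_ : core B ≤ _) ha
    intro A hA y hy
    exact NonUnitalAlgebra.subset_adjoin F (Set.mem_biUnion hA hy)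
  clear ha
  induction ha' using NonUnitalAlgebra.adjoin_induction with
  | mem y hy =>
    obtain ⟨A, hA, hyA⟩ := Set.mem_iUnion₂.1 hy
    have hle : A ≤ core B := le_sSup hA
    exact ⟨hle hyA, fun x => ⟨hle (hA.1 y hyA x).1, hle (hA.1 y hyA x).2⟩⟩
  | add y z _ _ hy hz =>
    refine ⟨add_mem hy.1 hz.1, fun x => ?_⟩
    rw [add_mul, mul_add]
    exact ⟨add_mem (hy.2 x).1 (hz.2 x).1, add_mem (hy.2 x).2 (hz.2 x).2⟩
  | zero => exact ⟨zero_mem _, fun x => by simp⟩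
  | mul y z _ _ hy hz =>
    refine ⟨mul_mem hy.1 hz.1, fun x => ⟨?_, ?_⟩⟩
    · have h : (y * z) * x = y * (z * x) + (y * x) * z := by
        rw [IsRightLeibniz.mul_mul_right y z x]; abel
      rw [h]
      exact add_mem (mul_mem hy.1 (hz.2 x).1) (mul_mem (hy.2 x).1 hz.1)
    · rw [IsRightLeibniz.mul_mul_right x y z]
      exact sub_mem (mul_mem (hy.2 x).2 hz.1) (mul_mem (hz.2 x).2 hy.1)
  | smul r y _ hy =>
    refine ⟨SMulMemClass.smul_mem r hy.1, fun x => ?_⟩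
    rw [smul_mul_assoc, mul_smul_comm]
    exact ⟨SMulMemClass.smul_mem r (hy.2 x).1, SMulMemClass.smul_mem r (hy.2 x).2⟩

/-- The subalgebra `B` is a weak c-ideal of `L`: there is a subideal `C` of `L` with `L = B + C`
(a sum of subspaces) and `B ∩ C ⊆ B_L`. -/
def IsWeakCIdeal (B : NonUnitalSubalgebra F L) : Prop :=
  ∃ C : NonUnitalSubalgebra F L, IsSubideal C ∧
    B.toSubmodule ⊔ C.toSubmodule = ⊤ ∧ B ⊓ C ≤ core B

end

end Leibniz

/-!
If `B` is solvable and `M` is a maximal subalgebra not containing `B`, let `C` be the last term of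
the derived series of `B` that is not contained in `M`. All terms of the derived series are ideals
of `L`, so `M + C = L` by maximality, and `M ∩ C` is an ideal of `L` because
`[M ∩ C, C] ⊆ C⁽¹⁾ ⊆ M ∩ C`; hence `M` is a weak c-ideal (`isWeakCIdeal_of_isSolvableSubalgebra`).

Conversely, suppose that `B` is not solvable and pick an ideal `K` of `L` that is maximal among
those containing no term of the derived series of `B`. Squares annihilate `L` from the right, so
their span can be added to `K` without harm and lies in `K` by maximality: `L ⧸ K` is a Lie
algebra. For the same reason it has no nonzero abelian ideal, so by Cartan's criterion it is
semisimple in characteristic zero. Two complementary nonzero ideals of `L ⧸ K` would both contain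
a term of the image of the derived series of `B`, which is absurd, so `K` is a maximal ideal of `L`
(`IsMaximalAvoiding.eq_top_of_lt`).

Finally take `x ∉ K`. The proper subalgebra `K + F x` lies in a maximal subalgebra `M`, and `M` does
not contain `B` because `B + K = L`. If `M` were a weak c-ideal with
subideal `C`, then, `L ⧸ K` being simple, either `C ⊆ K ⊆ M`, which contradicts `M + C = L`, or
`C + K = L`, and then `x ∈ M ∩ C + K ⊆ M_L + K = K`, since `M_L + K` is an ideal contained in `M`
(`le_or_sup_eq_top_of_isSubideal`, `exists_isCoatom_not_isWeakCIdeal`).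
-/

namespace Leibniz

/-! ### Ideals and the derived series -/

section Ideals

variable {F L : Type*} [Field F] [NonUnitalNonAssocRing L] [Module F L]

/-- The subspace `J` is a two-sided ideal of `L`. This is `IsIdeal` for subspaces, among which the
sum of two ideals is the lattice join. -/
def IsIdealSubmodule (J : Submodule F L) : Prop :=
  ∀ a ∈ J, ∀ x : L, a * x ∈ J ∧ x * a ∈ J

theorem isIdealSubmodule_toSubmodule {A : NonUnitalSubalgebra F L} (hA : IsIdeal A) :
    IsIdealSubmodule A.toSubmodule := hA

theorem IsIdealSubmodule.sup {J K : Submodule F L} (hJ : IsIdealSubmodule J)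
    (hK : IsIdealSubmodule K) : IsIdealSubmodule (J ⊔ K) := by
  intro a ha x
  obtain ⟨j, hj, k, hk, rfl⟩ := Submodule.mem_sup.1 ha
  rw [add_mul, mul_add]
  exact ⟨Submodule.add_mem_sup (hJ j hj x).1 (hK k hk x).1,
    Submodule.add_mem_sup (hJ j hj x).2 (hK k hk x).2⟩

/-- An ideal, as a subalgebra. -/
def IsIdealSubmodule.toSubalgebra {J : Submodule F L} (hJ : IsIdealSubmodule J) :
    NonUnitalSubalgebra F L :=
  J.toNonUnitalSubalgebra fun x y hx _ => (hJ x hx y).1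

/-- The sum of a subalgebra and an ideal, as a subalgebra. -/
def IsIdealSubmodule.supSubalgebra {J : Submodule F L} (hJ : IsIdealSubmodule J)
    (A : NonUnitalSubalgebra F L) : NonUnitalSubalgebra F L :=
  (A.toSubmodule ⊔ J).toNonUnitalSubalgebra fun x y hx hy => by
    obtain ⟨a, ha, j, hj, rfl⟩ := Submodule.mem_sup.1 hx
    obtain ⟨b, hb, k, hk, rfl⟩ := Submodule.mem_sup.1 hy
    rw [add_mul, mul_add, add_assoc]
    exact Submodule.add_mem_sup (A.mul_mem ha hb) (add_mem (hJ k hk a).2 (hJ j hj _).1)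

theorem IsIdealSubmodule.sup_eq_top_of_isCoatom [IsScalarTower F L L] [SMulCommClass F L L]
    {J : Submodule F L} (hJ : IsIdealSubmodule J)
    {M : NonUnitalSubalgebra F L} (hM : IsCoatom M) (h : ¬ J ≤ M.toSubmodule) :
    M.toSubmodule ⊔ J = ⊤ := by
  have hlt : M < hJ.supSubalgebra M := by
    refine lt_of_le_not_ge (fun x hx => (le_sup_left : M.toSubmodule ≤ M.toSubmodule ⊔ J) hx) ?_
    exact fun hle => h fun x hx => hle ((le_sup_right : J ≤ M.toSubmodule ⊔ J) hx)
  have htop := hM.2 _ hlt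
  refine Submodule.eq_top_iff'.2 fun x => ?_
  have hx : x ∈ hJ.supSubalgebra M := htop ▸ NonUnitalAlgebra.mem_top
  exact hx

theorem derived_succ_le_iff {B : NonUnitalSubalgebra F L} {n : ℕ} {P : Submodule F L} :
    derived B (n + 1) ≤ P ↔ ∀ x ∈ derived B n, ∀ y ∈ derived B n, x * y ∈ P := by
  rw [derived, Submodule.span_le]
  refine ⟨fun h x hx y hy => h ⟨x, hx, y, hy, rfl⟩, ?_⟩
  rintro h _ ⟨x, hx, y, hy, rfl⟩
  exact h x hx y hy

theorem mul_mem_derived_succ {B : NonUnitalSubalgebra F L} {n : ℕ} {x y : L}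
    (hx : x ∈ derived B n) (hy : y ∈ derived B n) : x * y ∈ derived B (n + 1) :=
  derived_succ_le_iff.1 le_rfl x hx y hy

variable [IsScalarTower F L L] [SMulCommClass F L L]

theorem isIdealSubmodule_derived [IsRightLeibniz L] {B : NonUnitalSubalgebra F L}
    (hB : IsIdeal B) (n : ℕ) : IsIdealSubmodule (derived B n) := by
  induction n with
  | zero => exact isIdealSubmodule_toSubmodule hB
  | succ n ih =>
    intro a ha x
    rw [derived] at ha
    induction ha using Submodule.span_induction with
    | mem z hz =>
      obtain ⟨y, hy, z, hz, rfl⟩ := hz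
      constructor
      · have h : (y * z) * x = y * (z * x) + (y * x) * z := by
          rw [IsRightLeibniz.mul_mul_right y z x]; abel
        rw [h]
        exact add_mem (mul_mem_derived_succ hy (ih z hz x).1)
          (mul_mem_derived_succ (ih y hy x).1 hz)
      · rw [IsRightLeibniz.mul_mul_right x y z]
        exact sub_mem (mul_mem_derived_succ (ih y hy x).2 hz)
          (mul_mem_derived_succ (ih z hz x).2 hy)
    | zero => simp
    | add y z _ _ hy hz =>
      rw [add_mul, mul_add]
      exact ⟨add_mem hy.1 hz.1, add_mem hy.2 hz.2⟩
    | smul r y _ hy =>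
      rw [smul_mul_assoc, mul_smul_comm]
      exact ⟨Submodule.smul_mem _ r hy.1, Submodule.smul_mem _ r hy.2⟩

theorem derived_antitone [IsRightLeibniz L] {B : NonUnitalSubalgebra F L} (hB : IsIdeal B) :
    Antitone (derived B) :=
  antitone_nat_of_succ_le fun n =>
    derived_succ_le_iff.2 fun x hx y _ => (isIdealSubmodule_derived hB n x hx y).1

end Ideals

/-! ### Solvable ideals -/

section Solvable

variable {F L : Type*} [Field F] [NonUnitalNonAssocRing L] [Module F L]
  [IsScalarTower F L L] [SMulCommClass F L L]

theorem isSubideal_of_isIdeal {C : NonUnitalSubalgebra F L} (hC : IsIdeal C) : IsSubideal C := by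
  by_cases h : C = ⊤
  · exact ⟨0, fun _ => ⊤, rfl, h.symm, fun i hi => absurd hi (Nat.not_lt_zero i)⟩
  · refine ⟨1, fun i => if i = 0 then ⊤ else C, by simp, by simp, fun i hi => ?_⟩
    obtain rfl : i = 0 := by omega
    simpa [IsIdealIn, IsIdeal, lt_top_iff_ne_top, h] using hC

/-- A complementing subideal is the last term of the derived series of `B` not contained in `M`. -/
theorem isWeakCIdeal_of_isSolvableSubalgebra [IsRightLeibniz L] {B M : NonUnitalSubalgebra F L}
    (hB : IsIdeal B) (hs : IsSolvableSubalgebra B) (hM : IsCoatom M) (hBM : ¬ B ≤ M) :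
    IsWeakCIdeal M := by
  classical
  obtain ⟨n, hn⟩ := hs
  have hex : ∃ n, derived B n ≤ M.toSubmodule := ⟨n, hn ▸ bot_le⟩
  obtain ⟨k, hk⟩ : ∃ k, Nat.find hex = k + 1 := by
    refine Nat.exists_eq_succ_of_ne_zero fun h0 => hBM ?_
    have h := Nat.find_spec hex
    rw [h0] at h
    exact h
  have hk1 : derived B (k + 1) ≤ M.toSubmodule := hk ▸ Nat.find_spec hex
  have hk0 : ¬ derived B k ≤ M.toSubmodule := Nat.find_min hex (by omega)
  have hC := isIdealSubmodule_derived hB k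
  have htop := hC.sup_eq_top_of_isCoatom hM hk0
  refine ⟨hC.toSubalgebra, isSubideal_of_isIdeal hC, htop, ?_⟩
  refine (isGreatest_core M).2 ⟨?_, inf_le_left⟩
  rintro a ⟨haM, haC⟩ x
  obtain ⟨m, hm, c, hc, rfl⟩ := Submodule.mem_sup.1 (htop ▸ Submodule.mem_top : x ∈ _)
  refine ⟨⟨?_, (hC a haC _).1⟩, ⟨?_, (hC a haC _).2⟩⟩
  · rw [mul_add]
    exact add_mem (mul_mem haM hm) (hk1 (mul_mem_derived_succ haC hc))
  · rw [add_mul]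
    exact add_mem (mul_mem hm haM) (hk1 (mul_mem_derived_succ hc haC))

end Solvable

/-! ### Lie quotients -/

section Quotient

universe u v

variable {F : Type u} {L : Type v} [Field F] [NonUnitalNonAssocRing L] [Module F L]

/-- The quotient of a Leibniz algebra by an ideal containing all squares is a Lie algebra. -/
theorem exists_lieAlgebra_quotient [IsScalarTower F L L] [SMulCommClass F L L] [IsRightLeibniz L]
    {K : Submodule F L} (hK : IsIdealSubmodule K) (hsq : ∀ x : L, x * x ∈ K) :
    ∃ (𝔤 : Type v) (_ : LieRing 𝔤) (_ : LieAlgebra F 𝔤) (f : L →ₗ[F] 𝔤),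
      Function.Surjective f ∧ LinearMap.ker f = K ∧ ∀ x y, f (x * y) = ⁅f x, f y⁆ := by
  let br : L ⧸ K → L ⧸ K → L ⧸ K := fun a b => K.mkQ (a.out * b.out)
  have hbr (x y : L) : br (K.mkQ x) (K.mkQ y) = K.mkQ (x * y) := by
    have hout (z : L) : z - (K.mkQ z).out ∈ K := by
      rw [← Submodule.Quotient.eq]
      exact (Quotient.out_eq (K.mkQ z)).symm
    refine ((Submodule.Quotient.eq K).2 ?_).symm
    have h : x * y - (K.mkQ x).out * (K.mkQ y).out =
        (x - (K.mkQ x).out) * y + (K.mkQ x).out * (y - (K.mkQ y).out) := by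
      rw [sub_mul, mul_sub]; abel
    rw [h]
    exact add_mem (hK _ (hout x) _).1 (hK _ (hout y) _).2
  have hsurj := K.mkQ_surjective
  let lieRing : LieRing (L ⧸ K) :=
    { (inferInstance : AddCommGroup (L ⧸ K)) with
      bracket := br
      add_lie := fun a b c => by
        obtain ⟨x, rfl⟩ := hsurj a
        obtain ⟨y, rfl⟩ := hsurj b
        obtain ⟨z, rfl⟩ := hsurj c
        change br (K.mkQ x + K.mkQ y) _ = br _ _ + br _ _
        rw [← map_add, hbr, hbr, hbr, add_mul, map_add]
      lie_add := fun a b c => by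
        obtain ⟨x, rfl⟩ := hsurj a
        obtain ⟨y, rfl⟩ := hsurj b
        obtain ⟨z, rfl⟩ := hsurj c
        change br _ (K.mkQ y + K.mkQ z) = br _ _ + br _ _
        rw [← map_add, hbr, hbr, hbr, mul_add, map_add]
      lie_self := fun a => by
        obtain ⟨x, rfl⟩ := hsurj a
        exact (hbr x x).trans ((Submodule.Quotient.mk_eq_zero K).2 (hsq x))
      leibniz_lie := fun a b c => by
        obtain ⟨x, rfl⟩ := hsurj a
        obtain ⟨y, rfl⟩ := hsurj b
        obtain ⟨z, rfl⟩ := hsurj c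
        change br _ (br _ _) = br (br _ _) _ + br _ (br _ _)
        simp only [hbr]
        rw [← map_add]
        refine (Submodule.Quotient.eq K).2 ?_
        -- anticommutativity modulo `K`, polarised from `hsq`
        have hanti : (x * z) * y + y * (x * z) ∈ K := by
          have h := sub_mem (sub_mem (hsq (x * z + y)) (hsq (x * z))) (hsq y)
          have e : (x * z + y) * (x * z + y) - (x * z) * (x * z) - y * y =
              (x * z) * y + y * (x * z) := by
            rw [add_mul, mul_add, mul_add]; abel
          rwa [e] at h
        have e : x * (y * z) - ((x * y) * z + y * (x * z)) =
            -((x * z) * y + y * (x * z)) := by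
          rw [IsRightLeibniz.mul_mul_right x y z]; abel
        rw [e]
        exact neg_mem hanti }
  let lieAlgebra : LieAlgebra F (L ⧸ K) :=
    { (inferInstance : Module F (L ⧸ K)) with
      lie_smul := fun r a b => by
        obtain ⟨x, rfl⟩ := hsurj a
        obtain ⟨y, rfl⟩ := hsurj b
        change br _ (r • K.mkQ y) = r • br _ _
        rw [← map_smul, hbr, hbr, mul_smul_comm, map_smul] }
  exact ⟨L ⧸ K, lieRing, lieAlgebra, K.mkQ, hsurj, K.ker_mkQ, fun x y => (hbr x y).symm⟩

variable {𝔤 : Type*} [LieRing 𝔤] [LieAlgebra F 𝔤] {f : L →ₗ[F] 𝔤}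

theorem isIdealSubmodule_comap (hf : ∀ x y, f (x * y) = ⁅f x, f y⁆) (I : LieIdeal F 𝔤) :
    IsIdealSubmodule (I.toSubmodule.comap f) := by
  intro a ha x
  simp only [Submodule.mem_comap, hf] at ha ⊢
  exact ⟨lie_mem_left F 𝔤 I _ _ ha, lie_mem_right F 𝔤 I _ _ ha⟩

theorem exists_lieIdeal_toSubmodule_eq_map (hf : ∀ x y, f (x * y) = ⁅f x, f y⁆)
    (hsurj : Function.Surjective f) {J : Submodule F L} (hJ : IsIdealSubmodule J) :
    ∃ I : LieIdeal F 𝔤, I.toSubmodule = J.map f := by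
  refine ⟨{ J.map f with lie_mem := ?_ }, rfl⟩
  rintro a _ ⟨j, hj, rfl⟩
  obtain ⟨x, rfl⟩ := hsurj a
  exact ⟨x * j, (hJ j hj x).2, hf x j⟩

theorem ker_lt_comap {I : LieIdeal F 𝔤} (hsurj : Function.Surjective f) (hI : I ≠ ⊥) :
    LinearMap.ker f < I.toSubmodule.comap f := by
  refine lt_of_le_not_ge (fun x hx => ?_) fun hle => hI ?_
  · rw [Submodule.mem_comap, LinearMap.mem_ker.1 hx]
    exact zero_mem _
  · rw [LieSubmodule.eq_bot_iff]
    intro a ha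
    obtain ⟨x, rfl⟩ := hsurj a
    exact hle ha

end Quotient

/-! ### Ideals avoiding the derived series -/

section Maximal

variable {F L : Type*} [Field F] [NonUnitalNonAssocRing L] [Module F L]

/-- The subspace `K` is an ideal containing no term of the derived series of `B`, and it is maximal
with this property. -/
structure IsMaximalAvoiding (B : NonUnitalSubalgebra F L) (K : Submodule F L) : Prop where
  isIdeal : IsIdealSubmodule K
  not_derived_le : ∀ n, ¬ derived B n ≤ K
  exists_derived_le : ∀ J, IsIdealSubmodule J → K < J → ∃ n, derived B n ≤ J

theorem exists_isMaximalAvoiding [FiniteDimensional F L] {B : NonUnitalSubalgebra F L}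
    (hB : ¬ IsSolvableSubalgebra B) : ∃ K : Submodule F L, IsMaximalAvoiding B K := by
  obtain ⟨K, ⟨hK, hKn⟩, hmax⟩ := WellFounded.has_min
    (wellFounded_gt : WellFounded ((· > ·) : Submodule F L → Submodule F L → Prop))
    {K | IsIdealSubmodule K ∧ ∀ n, ¬ derived B n ≤ K}
    ⟨⊥, by intro a ha x; simp_all, fun n hn => hB ⟨n, le_bot_iff.1 hn⟩⟩
  refine ⟨K, hK, hKn, fun J hJ hlt => ?_⟩
  by_contra! h
  exact hmax J ⟨hJ, h⟩ hlt

variable [SMulCommClass F L L]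

/-- The span of the squares can be added to `K`, because it annihilates `L` from the right and
therefore costs one step of the derived series. -/
theorem IsMaximalAvoiding.mul_self_mem [IsRightLeibniz L] {B : NonUnitalSubalgebra F L}
    {K : Submodule F L} (h : IsMaximalAvoiding B K) (x : L) : x * x ∈ K := by
  let S : Submodule F L := Submodule.span F (Set.range fun x : L => x * x)
  have hS0 (x s : L) (hs : s ∈ S) : x * s = 0 := by
    induction hs using Submodule.span_induction with
    | mem s hs =>
      obtain ⟨y, rfl⟩ := hs
      simp [IsRightLeibniz.mul_mul_right]
    | zero => simp
    | add y z _ _ hy hz => rw [mul_add, hy, hz, add_zero]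
    | smul r y _ hy => rw [mul_smul_comm, hy, smul_zero]
  have hS : IsIdealSubmodule S := by
    intro a ha x
    refine ⟨?_, by rw [hS0 x a ha]; exact zero_mem _⟩
    -- `x * a = 0`, so `a * x` is the polarised square of `a` and `x`
    have e : a * x = (a + x) * (a + x) - a * a - x * x := by
      rw [add_mul, mul_add, mul_add, hS0 x a ha]; abel
    rw [e]
    exact sub_mem (sub_mem (Submodule.subset_span ⟨_, rfl⟩) (Submodule.subset_span ⟨_, rfl⟩))
      (Submodule.subset_span ⟨_, rfl⟩)
  by_contra hx
  have hlt : K < K ⊔ S :=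
    left_lt_sup.2 fun hle => hx (hle (Submodule.subset_span ⟨x, rfl⟩))
  obtain ⟨n, hn⟩ := h.exists_derived_le _ (h.isIdeal.sup hS) hlt
  refine h.not_derived_le (n + 1) (derived_succ_le_iff.2 fun a ha b hb => ?_)
  obtain ⟨k, hk, s, hs, rfl⟩ := Submodule.mem_sup.1 (hn hb)
  obtain ⟨k', hk', s', hs', rfl⟩ := Submodule.mem_sup.1 (hn ha)
  rw [mul_add, hS0 _ s hs, add_zero]
  exact (h.isIdeal k hk _).2

variable [IsScalarTower F L L]

/-- The quotient by `K` is a semisimple Lie algebra any two nonzero ideals of which meet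
nontrivially, so it is simple. -/
theorem IsMaximalAvoiding.eq_top_of_lt [CharZero F] [FiniteDimensional F L] [IsRightLeibniz L]
    {B : NonUnitalSubalgebra F L} (hB : IsIdeal B) {K : Submodule F L}
    (h : IsMaximalAvoiding B K) {J : Submodule F L} (hJ : IsIdealSubmodule J) (hlt : K < J) :
    J = ⊤ := by
  obtain ⟨𝔤, _, _, f, hsurj, rfl, hf⟩ := exists_lieAlgebra_quotient h.isIdeal h.mul_self_mem
  have : FiniteDimensional F 𝔤 := Module.Finite.of_surjective f hsurj
  have : LieAlgebra.HasTrivialRadical F 𝔤 := by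
    rw [LieAlgebra.hasTrivialRadical_iff_no_abelian_ideals]
    intro I hI
    by_contra hne
    obtain ⟨n, hn⟩ := h.exists_derived_le _ (isIdealSubmodule_comap hf I) (ker_lt_comap hsurj hne)
    refine h.not_derived_le (n + 1) (derived_succ_le_iff.2 fun a ha b hb => ?_)
    rw [LinearMap.mem_ker, hf]
    have h0 : ⁅(⟨f a, hn ha⟩ : I), (⟨f b, hn hb⟩ : I)⁆ = 0 := trivial_lie_zero I I _ _
    exact congrArg Subtype.val h0
  obtain ⟨I, hI⟩ := exists_lieIdeal_toSubmodule_eq_map hf hsurj hJ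
  have hcomap : I.toSubmodule.comap f = J := by
    rw [hI, Submodule.comap_map_eq, sup_eq_left.2 hlt.le]
  obtain ⟨I', hc⟩ := exists_isCompl I
  have hbot : I' = ⊥ := by
    by_contra hne
    obtain ⟨m, hm⟩ :=
      h.exists_derived_le _ (isIdealSubmodule_comap hf I') (ker_lt_comap hsurj hne)
    obtain ⟨n, hn⟩ := h.exists_derived_le J hJ hlt
    refine h.not_derived_le (max m n) fun x hx => ?_
    have h1 : f x ∈ I' := hm (derived_antitone hB (le_max_left m n) hx)
    have h2 : x ∈ I.toSubmodule.comap f := hcomap ▸ hn (derived_antitone hB (le_max_right m n) hx)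
    have h3 : f x ∈ I ⊓ I' := ⟨h2, h1⟩
    rwa [hc.inf_eq_bot, LieSubmodule.mem_bot] at h3
  have htop : I = ⊤ := by simpa [hbot] using hc.sup_eq_top
  rw [← hcomap, htop]
  simp

/-- Modulo a maximal ideal `K`, a subideal is trivial or everything. -/
theorem le_or_sup_eq_top_of_isSubideal {K : Submodule F L} (hK : IsIdealSubmodule K)
    (hmax : ∀ J, IsIdealSubmodule J → K < J → J = ⊤) {C : NonUnitalSubalgebra F L}
    (hC : IsSubideal C) : C.toSubmodule ≤ K ∨ C.toSubmodule ⊔ K = ⊤ := by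
  obtain ⟨t, E, h0, rfl, hE⟩ := hC
  suffices key : ∀ i ≤ t, (E i).toSubmodule ≤ K ∨ (E i).toSubmodule ⊔ K = ⊤ from key t le_rfl
  intro i
  induction i with
  | zero => intro _; right; simp [h0]
  | succ i ih =>
    intro hi
    obtain ⟨-, hle, hid⟩ := hE i hi
    obtain h | htop := ih (by omega)
    · exact Or.inl (le_trans (fun x hx => hle hx) h)
    refine or_iff_not_imp_left.2 fun hnle => hmax _ ?_ (right_lt_sup.2 hnle)
    intro a ha x
    obtain ⟨c, hc, k, hk, rfl⟩ := Submodule.mem_sup.1 ha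
    obtain ⟨e, he, k', hk', rfl⟩ := Submodule.mem_sup.1 (htop ▸ Submodule.mem_top : x ∈ _)
    rw [add_mul, mul_add c, mul_add (e + k'), add_mul e, add_assoc, add_assoc]
    exact ⟨Submodule.add_mem_sup (hid c hc e he).1 (add_mem (hK k' hk' _).2 (hK k hk _).1),
      Submodule.add_mem_sup (hid c hc e he).2 (add_mem (hK k' hk' _).1 (hK k hk _).2)⟩

/-- The subalgebra `M` contains `K + F x` for some `x ∉ K`, where `L ⧸ K` is a simple Lie
algebra. -/
theorem exists_isCoatom_not_isWeakCIdeal [CharZero F] [FiniteDimensional F L] [IsRightLeibniz L]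
    {B : NonUnitalSubalgebra F L} (hB : IsIdeal B) (hs : ¬ IsSolvableSubalgebra B) :
    ∃ M : NonUnitalSubalgebra F L, IsCoatom M ∧ ¬ B ≤ M ∧ ¬ IsWeakCIdeal M := by
  obtain ⟨K, h⟩ := exists_isMaximalAvoiding hs
  have hK := h.isIdeal
  have hmax : ∀ J, IsIdealSubmodule J → K < J → J = ⊤ := fun J hJ => h.eq_top_of_lt hB hJ
  have hBK : B.toSubmodule ⊔ K = ⊤ :=
    hmax _ ((isIdealSubmodule_toSubmodule hB).sup hK) (right_lt_sup.2 (h.not_derived_le 0))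
  obtain ⟨x, -, hx⟩ := SetLike.not_le_iff_exists.1 (h.not_derived_le 0)
  have hmul : ∀ a ∈ K ⊔ F ∙ x, ∀ b ∈ K ⊔ F ∙ x, a * b ∈ K := by
    intro a ha b hb
    obtain ⟨k, hk, y, hy, rfl⟩ := Submodule.mem_sup.1 ha
    obtain ⟨k', hk', y', hy', rfl⟩ := Submodule.mem_sup.1 hb
    obtain ⟨r, rfl⟩ := Submodule.mem_span_singleton.1 hy
    obtain ⟨s, rfl⟩ := Submodule.mem_span_singleton.1 hy'
    rw [add_mul, mul_add (r • x), smul_mul_smul_comm]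
    exact add_mem (hK k hk _).1
      (add_mem (hK k' hk' _).2 (K.smul_mem _ (h.mul_self_mem x)))
  let A : NonUnitalSubalgebra F L := (K ⊔ F ∙ x).toNonUnitalSubalgebra
    fun a b ha hb => (le_sup_left : K ≤ K ⊔ F ∙ x) (hmul a ha b hb)
  have hA : A ≠ ⊤ := by
    intro htop
    have hall (a : L) : a ∈ K ⊔ F ∙ x := (htop ▸ NonUnitalAlgebra.mem_top : a ∈ A)
    exact h.not_derived_le 1
      (derived_succ_le_iff.2 fun a _ b _ => hmul a (hall a) b (hall b))
  have : WellFoundedGT (NonUnitalSubalgebra F L) :=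
    StrictMono.wellFoundedGT (f := NonUnitalSubalgebra.toSubmodule) fun _ _ hlt => hlt
  obtain ⟨M, hM, hAM⟩ := (eq_top_or_exists_le_coatom A).resolve_left hA
  have hKM : K ≤ M.toSubmodule := fun k hk =>
    hAM ((le_sup_left : K ≤ K ⊔ F ∙ x) hk)
  have hxM : x ∈ M :=
    hAM ((le_sup_right : F ∙ x ≤ K ⊔ F ∙ x) (Submodule.mem_span_singleton_self x))
  have hMtop : M.toSubmodule ≠ ⊤ := fun h' => hM.1 (NonUnitalAlgebra.toSubmodule_eq_top.1 h')
  refine ⟨M, hM, fun hBM => hMtop (top_le_iff.1 (hBK ▸ sup_le (fun b hb => hBM hb) hKM)), ?_⟩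
  rintro ⟨C, hC, hMC, hcore⟩
  obtain hCK | hCK := le_or_sup_eq_top_of_isSubideal hK hmax hC
  · rw [sup_eq_left.2 (hCK.trans hKM)] at hMC
    exact hMtop hMC
  · obtain ⟨⟨hideal, hcoreM⟩, -⟩ := isGreatest_core M
    have hcoreK : (core M).toSubmodule ≤ K := by
      by_contra hnle
      have htop := hmax _ ((isIdealSubmodule_toSubmodule hideal).sup hK) (right_lt_sup.2 hnle)
      exact hMtop (top_le_iff.1 (htop ▸ sup_le (fun m hm => hcoreM hm) hKM))
    obtain ⟨c, hc, k, hk, rfl⟩ := Submodule.mem_sup.1 (hCK ▸ Submodule.mem_top : x ∈ _)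
    have hcM : c ∈ M := by simpa using sub_mem hxM (hKM hk)
    exact hx (add_mem (hcoreK (hcore ⟨hcM, hc⟩)) hk)

end Maximal

end Leibniz

theorem theorem3p1 {F L : Type*} [Field F] [CharZero F]
    [NonUnitalNonAssocRing L] [Module F L] [IsScalarTower F L L] [SMulCommClass F L L]
    [Leibniz.IsRightLeibniz L] [FiniteDimensional F L] :
    (∀ B : NonUnitalSubalgebra F L, Leibniz.IsIdeal B →
      (Leibniz.IsSolvableSubalgebra B ↔
        ∀ M : NonUnitalSubalgebra F L, IsCoatom M → ¬ B ≤ M →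
          Leibniz.IsWeakCIdeal M)) ∧
    (Leibniz.IsSolvableSubalgebra (⊤ : NonUnitalSubalgebra F L) ↔
      ∀ M : NonUnitalSubalgebra F L, IsCoatom M →
        Leibniz.IsWeakCIdeal M) := by
  have main (B : NonUnitalSubalgebra F L) (hB : Leibniz.IsIdeal B) :
      Leibniz.IsSolvableSubalgebra B ↔
        ∀ M : NonUnitalSubalgebra F L, IsCoatom M → ¬ B ≤ M → Leibniz.IsWeakCIdeal M := by
    refine ⟨fun hs M hM hBM => Leibniz.isWeakCIdeal_of_isSolvableSubalgebra hB hs hM hBM,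
      fun h => ?_⟩
    by_contra hs
    obtain ⟨M, hM, hBM, hw⟩ := Leibniz.exists_isCoatom_not_isWeakCIdeal hB hs
    exact hw (h M hM hBM)
  have hideal : Leibniz.IsIdeal (⊤ : NonUnitalSubalgebra F L) :=
    fun _ _ _ => ⟨NonUnitalAlgebra.mem_top, NonUnitalAlgebra.mem_top⟩
  refine ⟨main, (main ⊤ hideal).trans ?_⟩
  exact forall₂_congr fun M hM => ⟨fun h => h fun hle => hM.1 (top_le_iff.1 hle), fun h _ => h⟩
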